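/- Let $n\ge 0$ and let $X$ be an $n$-dimensional compactum, i.e. a compact metrizable space with $\dim X=n$. Then for every integer $m>\lfloor n/2\rfloor$ there is a family $A_0,\dots,A_{m-1}$ of $m$ subsets of $X$ (not necessarily distinct) which is an $(\lfloor n/2\rfloor+1)$-cover of $X$, i.e. $X=A_{i_0}\cup\dots\cup A_{i_{\lfloor n/2\rfloor}}$ for any $\lfloor n/2\rfloor+1$ distinct indices $i_0,\dots,i_{\lfloor n/2\rfloor}$, and such that $\dim A_i\le 1$ for every $i$; if moreover $n\ge 1$, the sets can be chosen with $\dim A_i=1$ for every $i$. Here $\dim$ denotes the small inductive dimension, with $\dim\emptyset=-\infty$ (for separable metrizable spaces, hence for $X$ and all its subspaces, it agrees with the covering dimension and the large inductive dimension, up to the convention for $\emptyset$). -/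

import Mathlib

/-- An indexed family `A` of subsets of `X` is a `k`-cover if every subfamily consisting of `k`
members (that is, every choice of `k` distinct indices) covers `X`. -/
def IsKCover {X ι : Type*} (A : ι → Set X) (k : ℕ) : Prop :=
  ∀ s : Finset ι, s.card = k → ⋃ i ∈ s, A i = Set.univ

open Set Topology TopologicalSpace

/-! ### Inheritance of dimension bounds and clopen separation. -/

section General

variable {X Y : Type*} [TopologicalSpace X] [TopologicalSpace Y]

/-! It suffices to find zero-dimensional sets `B 0, B 1, ...` any `n + 1` of which cover `X`. The
sets `B (2 * i) ∪ B (2 * i + 1)` then have dimension at most one, and `n / 2 + 1` of them involve `2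
* (n / 2) + 2 ≥ n + 1` of the `B`'s.

The `B`'s come from general position: countably many disjoint closed pairs are separated by open
sets so that no point lies on `n + 1` of their frontiers (`exists_isOpen_frontier_card_lt`). The
separators are split into infinitely many families, each containing a base, and `B i` is the
complement of the frontiers of the `i`-th family.

If `n ≥ 1` and such a union is only zero-dimensional, it is enlarged by the finitely many
zero-dimensional pieces of `X`, one at a time. Each raises dimension zero to at most one and the
last stage is `X`, so dimension one occurs on the way. -/

theorem Topology.IsInducing.hasSmallInductiveDimensionLT {n : ℕ} {X Y : Type*}
    [TopologicalSpace X] [TopologicalSpace Y] {f : X → Y}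
    (hf : IsInducing f) (h : HasSmallInductiveDimensionLT Y n) :
    HasSmallInductiveDimensionLT X n := by
  induction n generalizing X Y with
  | zero =>
    rw [hasSmallInductiveDimensionLT_zero_iff] at h ⊢
    exact Function.isEmpty f
  | succ n ih =>
    cases h with
    | succ _ s hs h =>
      refine .succ _ _ (hs.isInducing hf) ?_
      rintro _ ⟨U, hU, rfl⟩
      have hm : MapsTo f (frontier (f ⁻¹' U)) (frontier U) :=
        fun x hx ↦ hf.continuous.frontier_preimage_subset U hx
      refine ih (f := hm.restrict) ?_ (h U hU)
      exact (hf.comp IsInducing.subtypeVal).codRestrict fun x ↦ hm x.2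

theorem HasSmallInductiveDimensionLT.subset {n : ℕ} {S T : Set X}
    (h : HasSmallInductiveDimensionLT T n) (hST : S ⊆ T) : HasSmallInductiveDimensionLT S n :=
  (IsEmbedding.inclusion hST).isInducing.hasSmallInductiveDimensionLT h

theorem HasSmallInductiveDimensionLT.image {n : ℕ} {f : X → Y} (hf : IsEmbedding f) {S : Set X}
    (h : HasSmallInductiveDimensionLT S n) : HasSmallInductiveDimensionLT (f '' S) n :=
  (hf.homeomorphImage S).symm.isInducing.hasSmallInductiveDimensionLT h

/-- A criterion bounding the dimension of a subset by means of open sets of the ambient space. -/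
theorem hasSmallInductiveDimensionLT_succ_of_frontier {n : ℕ} {S : Set X}
    (h : ∀ x ∈ S, ∀ U, IsOpen U → x ∈ U → ∃ W, IsOpen W ∧ x ∈ W ∧ W ⊆ U ∧
      HasSmallInductiveDimensionLT ↥(frontier W ∩ S) n) :
    HasSmallInductiveDimensionLT S (n + 1) := by
  refine .succ n {V | ∃ W, IsOpen W ∧ HasSmallInductiveDimensionLT ↥(frontier W ∩ S) n ∧
    Subtype.val ⁻¹' W = V} (isTopologicalBasis_of_isOpen_of_nhds ?_ ?_) ?_
  · rintro _ ⟨W, hW, -, rfl⟩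
    exact hW.preimage continuous_subtype_val
  · rintro ⟨x, hx⟩ V hxV hV
    obtain ⟨U, hU, rfl⟩ := isOpen_induced_iff.1 hV
    obtain ⟨W, hW, hxW, hWU, hd⟩ := h x hx U hU hxV
    exact ⟨_, ⟨W, hW, hd, rfl⟩, hxW, preimage_mono hWU⟩
  · rintro _ ⟨W, hW, hd, rfl⟩
    have hm : MapsTo (Subtype.val : S → X) (frontier (Subtype.val ⁻¹' W)) (frontier W ∩ S) :=
      fun x hx ↦ ⟨continuous_subtype_val.frontier_preimage_subset W hx, x.2⟩
    refine IsInducing.hasSmallInductiveDimensionLT (f := hm.restrict) ?_ hd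
    exact (IsInducing.subtypeVal.comp IsInducing.subtypeVal).codRestrict fun x ↦ hm x.2

/-- In a second countable zero-dimensional space, disjoint closed sets are separated by a clopen
set. -/
theorem exists_isClopen_of_disjoint_isClosed [SecondCountableTopology X]
    (h : HasSmallInductiveDimensionLT X 1) {A B : Set X} (hA : IsClosed A) (hB : IsClosed B)
    (hAB : Disjoint A B) : ∃ C, IsClopen C ∧ A ⊆ C ∧ Disjoint C B := by
  rw [hasSmallInductiveDimensionLT_one_iff] at h
  have key : ∀ x, ∃ W, IsClopen W ∧ x ∈ W ∧ (Disjoint W A ∨ Disjoint W B) := by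
    intro x
    by_cases hx : x ∈ A
    · obtain ⟨W, hW, hxW, hWB⟩ := h.exists_subset_of_mem_open
        (disjoint_left.1 hAB hx : x ∈ Bᶜ) hB.isOpen_compl
      exact ⟨W, hW, hxW, .inr (disjoint_left.2 fun y hy ↦ hWB hy)⟩
    · obtain ⟨W, hW, hxW, hWA⟩ := h.exists_subset_of_mem_open
        (hx : x ∈ Aᶜ) hA.isOpen_compl
      exact ⟨W, hW, hxW, .inl (disjoint_left.2 fun y hy ↦ hWA hy)⟩
  choose W hW hxW hWd using key
  obtain ⟨s, hs, hsW⟩ := TopologicalSpace.countable_cover_nhds fun x ↦ (hW x).isOpen.mem_nhds (hxW x)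
  rcases s.eq_empty_or_nonempty with rfl | hne
  · refine ⟨∅, isClopen_empty, fun x _ ↦ ?_, disjoint_bot_left⟩
    have := hsW ▸ mem_univ x
    simp at this
  obtain ⟨f, rfl⟩ := hs.exists_eq_range hne
  let V : ℕ → Set X := fun k ↦ W (f k)
  have hV : ∀ k, IsOpen (disjointed V k) := fun k ↦
    (disjointedRec (f := V) (p := IsClopen) (fun _ i (hi : IsClopen _) ↦ hi.diff (hW (f i)))
      (hW (f k))).isOpen
  have hcov : ∀ x, ∃ k, x ∈ disjointed V k := by
    intro x
    have : x ∈ ⋃ k, disjointed V k := by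
      rw [iUnion_disjointed]
      have := hsW ▸ mem_univ x
      simpa [V] using this
    simpa using this
  have hdis : ∀ {x j k}, x ∈ disjointed V j → x ∈ disjointed V k → j = k := by
    intro x j k hj hk
    by_contra hjk
    exact disjoint_left.1 (disjoint_disjointed V hjk) hj hk
  -- The sets `disjointed V k` form an open partition, so any union of them is clopen.
  refine ⟨⋃ k ∈ {k | Disjoint (V k) B}, disjointed V k, ⟨⟨?_⟩, ?_⟩, ?_, ?_⟩
  · have : (⋃ k ∈ {k | Disjoint (V k) B}, disjointed V k)ᶜ =
        ⋃ k ∈ {k | ¬ Disjoint (V k) B}, disjointed V k := by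
      ext x
      obtain ⟨k, hk⟩ := hcov x
      simp only [mem_compl_iff, mem_iUnion, mem_ofPred_eq, exists_prop, not_exists, not_and]
      constructor
      · exact fun H ↦ ⟨k, fun hd ↦ H k hd hk, hk⟩
      · rintro ⟨j, hj, hxj⟩ i hi hxi
        exact hj (hdis hxi hxj ▸ hi)
    rw [this]
    exact isOpen_biUnion fun k _ ↦ hV k
  · exact isOpen_biUnion fun k _ ↦ hV k
  · intro x hx
    obtain ⟨k, hk⟩ := hcov x
    refine mem_biUnion (x := k) ((hWd (f k)).resolve_left fun hd ↦ ?_) hk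
    exact disjoint_left.1 hd (disjointed_subset V k hk) hx
  · simp only [disjoint_iUnion_left]
    exact fun k hk ↦ hk.mono_left (disjointed_subset V k)

/-- Disjoint closed sets of a normal space have open neighbourhoods with disjoint closures. -/
theorem exists_isOpen_disjoint_closure [NormalSpace X] {A B : Set X} (hA : IsClosed A)
    (hB : IsClosed B) (hAB : Disjoint A B) : ∃ U V, IsOpen U ∧ IsOpen V ∧ A ⊆ U ∧ B ⊆ V ∧
      Disjoint (closure U) (closure V) := by
  obtain ⟨U, hU, hAU, hUB⟩ := normal_exists_closure_subset hA hB.isOpen_compl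
    (subset_compl_iff_disjoint_right.2 hAB)
  obtain ⟨V, hV, hBV, hVU⟩ := normal_exists_closure_subset hB isClosed_closure.isOpen_compl
    (subset_compl_comm.1 hUB)
  exact ⟨U, V, hU, hV, hAU, hBV, (subset_compl_iff_disjoint_left.1 hVU)⟩

end General

/-! ### Closed sums and separation around a zero-dimensional set. -/

section Metrizable

variable {X : Type*} [TopologicalSpace X] [MetrizableSpace X] [SecondCountableTopology X]

/-- The countable closed sum theorem in dimension zero. -/
theorem hasSmallInductiveDimensionLT_one_of_iUnion {K : ℕ → Set X} (hK : ∀ j, IsClosed (K j))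
    (hcov : ⋃ j, K j = univ) (hd : ∀ j, HasSmallInductiveDimensionLT (K j) 1) :
    HasSmallInductiveDimensionLT X 1 := by
  rw [hasSmallInductiveDimensionLT_one_iff]
  refine isTopologicalBasis_of_isOpen_of_nhds (fun U hU ↦ hU.isOpen) fun x O hxO hO ↦ ?_
  let S := {p : Set X × Set X //
    IsOpen p.1 ∧ IsOpen p.2 ∧ Disjoint (closure p.1) (closure p.2)}
  -- Each step distributes `K j` between the two sides while keeping their closures disjoint; in the
  -- limit the sides are complementary open sets.
  have step : ∀ (j : ℕ) (p : S), ∃ q : S,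
      p.1.1 ⊆ q.1.1 ∧ p.1.2 ⊆ q.1.2 ∧ K j ⊆ q.1.1 ∪ q.1.2 := by
    rintro j ⟨⟨U, V⟩, hU, hV, hUV⟩
    obtain ⟨C, hC, hUC, hCV⟩ := exists_isClopen_of_disjoint_isClosed (hd j)
      (A := Subtype.val ⁻¹' closure U) (B := Subtype.val ⁻¹' closure V)
      (isClosed_closure.preimage continuous_subtype_val)
      (isClosed_closure.preimage continuous_subtype_val) (hUV.preimage _)
    have hemb := (hK j).isClosedEmbedding_subtypeVal
    obtain ⟨U', V', hU', hV', hAU, hBV, hd'⟩ := exists_isOpen_disjoint_closure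
      (A := closure U ∪ Subtype.val '' C) (B := closure V ∪ Subtype.val '' Cᶜ)
      (isClosed_closure.union (hemb.isClosedMap _ hC.isClosed))
      (isClosed_closure.union (hemb.isClosedMap _ hC.compl.isClosed)) (by
        rw [disjoint_left]
        rintro y (hy | ⟨y, hy, rfl⟩) (hy' | ⟨z, hz, hzy⟩)
        · exact disjoint_left.1 hUV hy hy'
        · subst hzy
          exact hz (hUC hy)
        · exact disjoint_left.1 hCV hy hy'
        · exact hz (Subtype.ext hzy ▸ hy))
    refine ⟨⟨(U', V'), hU', hV', hd'⟩, (subset_closure.trans subset_union_left).trans hAU,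
      (subset_closure.trans subset_union_left).trans hBV, fun y hy ↦ ?_⟩
    by_cases hyC : (⟨y, hy⟩ : K j) ∈ C
    · exact .inl (hAU (.inr ⟨_, hyC, rfl⟩))
    · exact .inr (hBV (.inr ⟨_, hyC, rfl⟩))
  choose next h1 h2 h3 using step
  obtain ⟨U₀, V₀, hU₀, hV₀, hxU, hOV, hd₀⟩ := exists_isOpen_disjoint_closure
    (isClosed_singleton (x := x)) hO.isClosed_compl (by simpa using hxO)
  let p : ℕ → S := fun k ↦ Nat.rec ⟨(U₀, V₀), hU₀, hV₀, hd₀⟩ next k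
  have m1 : Monotone fun k ↦ (p k).1.1 := monotone_nat_of_le_succ fun k ↦ h1 k (p k)
  have m2 : Monotone fun k ↦ (p k).1.2 := monotone_nat_of_le_succ fun k ↦ h2 k (p k)
  have hdis : Disjoint (⋃ k, (p k).1.1) (⋃ k, (p k).1.2) := by
    rw [disjoint_left]
    intro y hy hy'
    obtain ⟨i, hi⟩ := mem_iUnion.1 hy
    obtain ⟨j, hj⟩ := mem_iUnion.1 hy'
    exact disjoint_left.1 (p (max i j)).2.2.2 (subset_closure (m1 (le_max_left i j) hi))
      (subset_closure (m2 (le_max_right i j) hj))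
  have hcompl : (⋃ k, (p k).1.1)ᶜ = ⋃ k, (p k).1.2 := by
    refine Subset.antisymm (fun y hy ↦ ?_) (subset_compl_iff_disjoint_left.2 hdis)
    obtain ⟨j, hj⟩ := mem_iUnion.1 (hcov ▸ mem_univ y)
    rcases h3 j (p j) hj with hj | hj
    · exact absurd (mem_iUnion.2 ⟨j + 1, hj⟩) hy
    · exact mem_iUnion.2 ⟨j + 1, hj⟩
  refine ⟨⋃ k, (p k).1.1, ⟨⟨?_⟩, isOpen_iUnion fun k ↦ (p k).2.1⟩,
    mem_iUnion.2 ⟨0, hxU rfl⟩, fun y hy ↦ ?_⟩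
  · rw [hcompl]
    exact isOpen_iUnion fun k ↦ (p k).2.2.1
  · by_contra hyO
    exact disjoint_left.1 hdis hy (mem_iUnion.2 ⟨0, hOV hyO⟩)

/-- Open sets are `F_σ` in a metrizable space, so differences of closed sets reduce to the closed
sum theorem. -/
theorem hasSmallInductiveDimensionLT_one_of_subset_iUnion_diff {S : Set X} {F G : ℕ → Set X}
    (hF : ∀ j, IsClosed (F j)) (hG : ∀ j, IsClosed (G j)) (hcov : S ⊆ ⋃ j, F j \ G j)
    (hd : ∀ j, HasSmallInductiveDimensionLT ↥(S ∩ (F j \ G j)) 1) :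
    HasSmallInductiveDimensionLT S 1 := by
  have hH : ∀ j, ∃ H : ℕ → Set X, (∀ k, IsClosed (H k)) ∧ (G j)ᶜ = ⋃ k, H k := by
    intro j
    let _ := metrizableSpaceMetric X
    obtain ⟨H, hH, -, hU, -⟩ := (hG j).isOpen_compl.exists_iUnion_isClosed
    exact ⟨H, hH, hU.symm⟩
  choose H hH hGH using hH
  refine hasSmallInductiveDimensionLT_one_of_iUnion
    (K := fun k ↦ (Subtype.val : S → X) ⁻¹' (F k.unpair.1 ∩ H k.unpair.1 k.unpair.2))
    (fun k ↦ ((hF _).inter (hH _ _)).preimage continuous_subtype_val) ?_ fun k ↦ ?_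
  · refine eq_univ_of_forall fun x ↦ ?_
    obtain ⟨j, hj, hj'⟩ := mem_iUnion.1 (hcov x.2)
    obtain ⟨k, hk⟩ := mem_iUnion.1 (hGH j ▸ hj' : x.1 ∈ ⋃ k, H j k)
    exact mem_iUnion.2 ⟨Nat.pair j k, by simpa using ⟨hj, hk⟩⟩
  · have hm : MapsTo (Subtype.val : S → X)
        (Subtype.val ⁻¹' (F k.unpair.1 ∩ H k.unpair.1 k.unpair.2))
        (S ∩ (F k.unpair.1 \ G k.unpair.1)) := fun x hx ↦
      ⟨x.2, hx.1, (hGH k.unpair.1).symm.subset (mem_iUnion.2 ⟨_, hx.2⟩)⟩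
    refine IsInducing.hasSmallInductiveDimensionLT (f := hm.restrict) ?_ (hd _)
    exact (IsInducing.subtypeVal.comp IsInducing.subtypeVal).codRestrict fun x ↦ hm x.2

/-- Disjoint closed sets can be separated by an open set whose frontier avoids a given
zero-dimensional set. -/
theorem exists_isOpen_disjoint_frontier {E A B : Set X} (hE : HasSmallInductiveDimensionLT E 1)
    (hA : IsClosed A) (hB : IsClosed B) (hAB : Disjoint A B) :
    ∃ U, IsOpen U ∧ A ⊆ U ∧ Disjoint U B ∧ Disjoint (frontier U) E := by
  obtain ⟨G, H, hG, hH, hAG, hBH, hGH⟩ := exists_isOpen_disjoint_closure hA hB hAB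
  obtain ⟨C, hC, hGC, hCH⟩ := exists_isClopen_of_disjoint_isClosed hE
    (A := Subtype.val ⁻¹' closure G) (B := Subtype.val ⁻¹' closure H)
    (isClosed_closure.preimage continuous_subtype_val)
    (isClosed_closure.preimage continuous_subtype_val) (hGH.preimage _)
  have sep : ∀ {D D' : Set E} {O F : Set X}, IsClosed D → Disjoint D D' → IsOpen O → F ⊆ O →
      Disjoint D (Subtype.val ⁻¹' closure O) → Disjoint (closure (Subtype.val '' D))
        (F ∪ Subtype.val '' D') := by
    intro D D' O F hD hDD' hO hFO hDO
    rw [disjoint_union_right]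
    constructor
    · refine ((Disjoint.closure_left ?_ hO)).mono_right hFO
      rw [disjoint_left]
      rintro _ ⟨y, hy, rfl⟩ hyO
      exact disjoint_left.1 hDO hy (subset_closure hyO)
    · rw [disjoint_right]
      rintro _ ⟨y, hy, rfl⟩ hyc
      refine disjoint_left.1 hDD' ?_ hy
      rwa [← hD.closure_eq, IsEmbedding.subtypeVal.closure_eq_preimage_closure_image]
  -- Neither set meets the closure of the other, so complete normality applies. The buffers `G` and
  -- `H` keep the closures, taken in `X`, of `C` and `Cᶜ` away from `B` and `A`.
  have h1 : Disjoint (closure (A ∪ Subtype.val '' C)) (B ∪ Subtype.val '' Cᶜ) := by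
    rw [closure_union, hA.closure_eq, disjoint_union_left]
    refine ⟨disjoint_union_right.2 ⟨hAB, ?_⟩,
      sep hC.isClosed disjoint_compl_right hH hBH hCH⟩
    rw [disjoint_right]
    rintro _ ⟨y, hy, rfl⟩ hyA
    exact hy (hGC (subset_closure (hAG hyA)))
  have h2 : Disjoint (A ∪ Subtype.val '' C) (closure (B ∪ Subtype.val '' Cᶜ)) := by
    rw [closure_union, hB.closure_eq, disjoint_union_right]
    refine ⟨disjoint_union_left.2 ⟨hAB, ?_⟩, (sep hC.compl.isClosed disjoint_compl_left hG hAG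
      (disjoint_left.2 fun y hy hyG ↦ hy (hGC hyG))).symm⟩
    rw [disjoint_left]
    rintro _ ⟨y, hy, rfl⟩ hyB
    exact disjoint_left.1 hCH hy (subset_closure (hBH hyB))
  let _ := metrizableSpaceMetric X
  obtain ⟨U, V, hU, hV, hU1, hV1, hUV⟩ :=
    separatedNhds_iff_disjoint.2 (CompletelyNormalSpace.completely_normal h1 h2)
  refine ⟨U, hU, subset_union_left.trans hU1,
    hUV.mono_right (subset_union_left.trans hV1), disjoint_left.2 fun y hy hyE ↦ ?_⟩
  by_cases hyC : (⟨y, hyE⟩ : E) ∈ C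
  · rw [hU.frontier_eq] at hy
    exact hy.2 (hU1 (.inr ⟨_, hyC, rfl⟩))
  · exact disjoint_left.1 (hUV.closure_left hV) (frontier_subset_closure hy)
      (hV1 (.inr ⟨_, hyC, rfl⟩))

/-- Neighbourhoods can be chosen with frontier missing `P`; the rest of the frontier lies in `Q`. -/
theorem HasSmallInductiveDimensionLT.union {P Q : Set X} (hP : HasSmallInductiveDimensionLT P 1)
    (hQ : HasSmallInductiveDimensionLT Q 1) :
    HasSmallInductiveDimensionLT ↥(P ∪ Q) 2 := by
  refine hasSmallInductiveDimensionLT_succ_of_frontier fun x _ U hU hxU ↦ ?_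
  obtain ⟨W, hW, hxW, hWU, hWP⟩ := exists_isOpen_disjoint_frontier hP
    (isClosed_singleton (x := x)) hU.isClosed_compl (by simpa using hxU)
  refine ⟨W, hW, hxW rfl, disjoint_compl_right_iff_subset.1 hWU, hQ.subset ?_⟩
  rintro y ⟨hy, hyP | hyQ⟩
  · exact absurd hyP (disjoint_left.1 hWP hy)
  · exact hyQ

end Metrizable

/-- The decomposition theorem: a separable metrizable space of dimension less than `n` is the
union of `n` zero-dimensional subsets. -/
theorem HasSmallInductiveDimensionLT.exists_decomposition {n : ℕ} {X : Type*} [TopologicalSpace X]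
    [MetrizableSpace X] [SecondCountableTopology X] (h : HasSmallInductiveDimensionLT X n) :
    ∃ P : ℕ → Set X, (∀ i, HasSmallInductiveDimensionLT (P i) 1) ∧ ∀ x, ∃ i < n, x ∈ P i := by
  induction n generalizing X with
  | zero =>
    rw [hasSmallInductiveDimensionLT_zero_iff] at h
    exact ⟨fun _ ↦ ∅, fun _ ↦ inferInstance, fun x ↦ isEmptyElim x⟩
  | succ n ih =>
    cases h with
    | succ _ s hs h =>
    obtain ⟨t, hts, htc, ht⟩ := hs.exists_countable
    obtain ⟨U, hU⟩ := (htc.insert ∅).exists_eq_range (insert_nonempty _ _)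
    have hd : ∀ j, HasSmallInductiveDimensionLT (frontier (U j)) n := by
      intro j
      rcases (hU ▸ mem_range_self j : U j ∈ insert ∅ t) with hj | hj
      · rw [hj, frontier_empty]
        infer_instance
      · exact h _ (hts hj)
    choose Q hQ hQc using fun j ↦ ih (hd j)
    -- Removing earlier frontiers assigns each point to the first frontier containing it.
    let G : ℕ → Set X := fun j ↦ ⋃ l ∈ Finset.range j, frontier (U l)
    refine ⟨fun i ↦ Nat.casesOn i (⋃ j, frontier (U j))ᶜ
      fun i ↦ ⋃ j, Subtype.val '' Q j i \ G j, fun i ↦ ?_, fun x ↦ ?_⟩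
    · cases i with
      | zero =>
        refine hasSmallInductiveDimensionLT_succ_of_frontier fun x hx O hO hxO ↦ ?_
        obtain ⟨W, hW, hxW, hWO⟩ := ht.exists_subset_of_mem_open hxO hO
        refine ⟨W, ht.isOpen hW, hxW, hWO, ?_⟩
        obtain ⟨j, rfl⟩ := (hU ▸ mem_insert_of_mem _ hW : W ∈ range U)
        rw [hasSmallInductiveDimensionLT_zero_iff, isEmpty_coe_sort]
        exact eq_empty_of_forall_notMem fun y hy ↦ hy.2 (mem_iUnion.2 ⟨j, hy.1⟩)
      | succ i =>
        refine hasSmallInductiveDimensionLT_one_of_subset_iUnion_diff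
          (F := fun j ↦ frontier (U j)) (G := G) (fun j ↦ isClosed_frontier)
          (fun j ↦ isClosed_biUnion_finset fun l _ ↦ isClosed_frontier)
          (iUnion_mono fun j ↦ sdiff_subset_sdiff_left (Subtype.coe_image_subset _ _))
          fun j ↦ ((hQ j i).image IsEmbedding.subtypeVal).subset ?_
        rintro x ⟨hx, hxj, hxG⟩
        obtain ⟨l, ⟨y, hy, rfl⟩, hxl⟩ := mem_iUnion.1 hx
        rcases lt_trichotomy l j with hlj | rfl | hjl
        · exact absurd (mem_biUnion (x := l) (by simpa using hlj) y.2) hxG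
        · exact ⟨y, hy, rfl⟩
        · exact absurd (mem_biUnion (x := j) (by simpa using hjl) hxj) hxl
    · by_cases hx : ∃ j, x ∈ frontier (U j)
      · classical
        obtain ⟨i, hi, hxi⟩ := hQc (Nat.find hx) ⟨x, Nat.find_spec hx⟩
        refine ⟨i + 1, by omega, mem_iUnion.2 ⟨Nat.find hx, ⟨_, hxi, rfl⟩, ?_⟩⟩
        simp only [G, mem_iUnion, not_exists]
        intro l hl
        exact Nat.find_min hx (by simpa using hl)
      · exact ⟨0, by omega, by simpa using hx⟩

/-! ### Frontiers in general position and the resulting covers. -/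

section GeneralPosition

variable {X : Type*} [TopologicalSpace X] [MetrizableSpace X] [SecondCountableTopology X]

/-- Countably many pairs of disjoint closed sets in a space of dimension less than `n` can be
separated by open sets such that no point lies on `n` of their frontiers. -/
theorem HasSmallInductiveDimensionLT.exists_isOpen_frontier_card_lt {n : ℕ}
    (h : HasSmallInductiveDimensionLT X n) {A B : ℕ → Set X} (hA : ∀ k, IsClosed (A k))
    (hB : ∀ k, IsClosed (B k)) (hAB : ∀ k, Disjoint (A k) (B k)) :
    ∃ U : ℕ → Set X, (∀ k, IsOpen (U k) ∧ A k ⊆ U k ∧ Disjoint (U k) (B k)) ∧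
      ∀ (x : X) (T : Finset ℕ), (∀ l ∈ T, x ∈ frontier (U l)) → T.card < n := by
  classical
  obtain ⟨P, hP, hPc⟩ := h.exists_decomposition
  -- `c x` counts the frontiers through `x` so far. A piece `P i` containing `x` with `c x ≤ i < n`
  -- bounds this count.
  let S := {c : X → ℕ // (∀ j, IsClosed {x | j ≤ c x}) ∧ ∀ x, ∃ i < n, c x ≤ i ∧ x ∈ P i}
  have step : ∀ (k : ℕ) (c : S), ∃ (U : Set X) (c' : S),
      (IsOpen U ∧ A k ⊆ U ∧ Disjoint U (B k)) ∧
        ∀ x, c'.1 x = c.1 x + if x ∈ frontier U then 1 else 0 := by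
    rintro k ⟨c, hc, hcP⟩
    -- Only where `i = c x` could an increment break the invariant, so the new frontier must avoid
    -- this set.
    have hE : HasSmallInductiveDimensionLT {x | x ∈ P (c x)} 1 := by
      refine hasSmallInductiveDimensionLT_one_of_subset_iUnion_diff
        (F := fun j ↦ {x | j ≤ c x}) (G := fun j ↦ {x | j + 1 ≤ c x}) hc (fun j ↦ hc _)
        (fun x _ ↦ mem_iUnion.2 ⟨c x, by simp⟩) fun j ↦ (hP j).subset ?_
      rintro x ⟨hx, hj, hj'⟩
      have : c x = j := by
        simp only [mem_ofPred_eq] at hj hj'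
        omega
      exact this ▸ hx
    obtain ⟨U, hU, hAU, hUB, hUE⟩ := exists_isOpen_disjoint_frontier hE (hA k) (hB k) (hAB k)
    refine ⟨U, ⟨fun x ↦ c x + if x ∈ frontier U then 1 else 0, fun j ↦ ?_, fun x ↦ ?_⟩,
      ⟨hU, hAU, hUB⟩, fun x ↦ rfl⟩
    -- For `j = 0` the truncated `j - 1` is harmless: the first set is already everything.
    · convert (hc j).union ((hc (j - 1)).inter (isClosed_frontier (s := U))) using 1
      ext x
      by_cases hx : x ∈ frontier U <;> simp [hx] <;> omega
    · obtain ⟨i, hi, hci, hxi⟩ := hcP x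
      refine ⟨i, hi, ?_, hxi⟩
      dsimp only
      split_ifs with hx
      · rcases hci.eq_or_lt with rfl | hlt
        · exact absurd hxi (disjoint_left.1 hUE hx)
        · exact hlt
      · exact hci
  choose U next hU hnext using step
  let c : ℕ → S := fun k ↦ Nat.rec ⟨fun _ ↦ 0, fun j ↦ by simp [isClosed_const],
    fun x ↦ by simpa using hPc x⟩ next k
  have hc : ∀ k x, (c k).1 x = ((Finset.range k).filter fun l ↦ x ∈ frontier (U l (c l))).card := by
    intro k x
    induction k with
    | zero => rfl
    | succ k ih =>
      rw [Finset.range_add_one, Finset.filter_insert]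
      refine (hnext k (c k) x).trans ?_
      rw [ih]
      split_ifs with hx
      · rw [Finset.card_insert_of_notMem (by simp)]
      · rfl
  refine ⟨fun k ↦ U k (c k), fun k ↦ hU k (c k), fun x T hT ↦ ?_⟩
  obtain ⟨k, hk⟩ := T.exists_nat_subset_range
  obtain ⟨i, hi, hci, -⟩ := (c k).2.2 x
  refine lt_of_le_of_lt (le_trans ?_ hci) hi
  rw [hc]
  exact Finset.card_le_card fun l hl ↦ Finset.mem_filter.2 ⟨hk hl, hT l hl⟩

/-- A separable metrizable space of dimension less than `n` has a sequence of zero-dimensional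
subsets any `n` of which cover the space. -/
theorem HasSmallInductiveDimensionLT.exists_zero_dimensional_cover {n : ℕ}
    (h : HasSmallInductiveDimensionLT X n) :
    ∃ B : ℕ → Set X, (∀ i, HasSmallInductiveDimensionLT (B i) 1) ∧
      ∀ (x : X) (T : Finset ℕ), (∀ i ∈ T, x ∉ B i) → T.card < n := by
  classical
  obtain ⟨b, hbc, -, hb⟩ := exists_countable_basis X
  obtain ⟨u, hu⟩ := (hbc.insert ∅).exists_eq_range (insert_nonempty _ _)
  have hub : ∀ W ∈ b, ∃ a, u a = W := fun W hW ↦ (hu ▸ mem_insert_of_mem _ hW : W ∈ range u)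
  have huo : ∀ a, IsOpen (u a) := by
    intro a
    rcases (hu ▸ mem_range_self a : u a ∈ insert ∅ b) with ha | ha
    · simp [ha]
    · exact hb.isOpen ha
  -- The first coordinate labels the family, the other two a pair of basic sets; pairs without
  -- closure inclusion get the trivial task of separating `∅`.
  let e : ℕ × ℕ × ℕ ≃ ℕ := Denumerable.eqv _
  obtain ⟨U, hU, hUc⟩ := h.exists_isOpen_frontier_card_lt
    (A := fun k ↦ if closure (u (e.symm k).2.1) ⊆ u (e.symm k).2.2 then
      closure (u (e.symm k).2.1) else ∅)
    (B := fun k ↦ (u (e.symm k).2.2)ᶜ)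
    (fun k ↦ by split_ifs <;> simp) (fun k ↦ (huo _).isClosed_compl)
    (fun k ↦ by
      split_ifs with hk
      · exact disjoint_compl_right_iff_subset.2 hk
      · exact disjoint_bot_left)
  refine ⟨fun i ↦ {x | ∀ p, x ∉ frontier (U (e (i, p)))}, fun i ↦ ?_, fun x T hT ↦ ?_⟩
  · refine hasSmallInductiveDimensionLT_succ_of_frontier fun x _ O hO hxO ↦ ?_
    obtain ⟨V, hV, hxV, hVO⟩ := hb.exists_subset_of_mem_open hxO hO
    obtain ⟨V', hV', hxV', hVV⟩ := hb.exists_closure_subset ((hb.isOpen hV).mem_nhds hxV)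
    obtain ⟨a, rfl⟩ := hub V hV
    obtain ⟨a', rfl⟩ := hub V' hV'
    obtain ⟨h1, h2, h3⟩ := hU (e (i, a', a))
    simp only [Equiv.symm_apply_apply, if_pos hVV] at h2 h3
    refine ⟨_, h1, h2 (subset_closure hxV'),
      (disjoint_compl_right_iff_subset.1 h3).trans hVO, ?_⟩
    rw [hasSmallInductiveDimensionLT_zero_iff, isEmpty_coe_sort]
    exact eq_empty_of_forall_notMem fun y hy ↦ hy.2 _ hy.1
  · have hT' : ∀ i ∈ T, ∃ p, x ∈ frontier (U (e (i, p))) := by simpa using hT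
    choose! p hp using hT'
    rw [← Finset.card_image_of_injective T (f := fun i ↦ e (i, p i))
      fun i j hij ↦ congrArg Prod.fst (e.injective hij)]
    exact hUc x _ (by simpa using hp)

/-- In a finite-dimensional separable metrizable space which is not zero-dimensional, every
zero-dimensional set lies in a one-dimensional one. -/
theorem HasSmallInductiveDimensionLT.exists_superset_one_dimensional {n : ℕ}
    (h : HasSmallInductiveDimensionLT X n) (h1 : ¬ HasSmallInductiveDimensionLT X 1)
    {A : Set X} (hA : HasSmallInductiveDimensionLT A 1) :
    ∃ A', A ⊆ A' ∧ HasSmallInductiveDimensionLT A' 2 ∧ ¬ HasSmallInductiveDimensionLT A' 1 := by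
  by_contra! H
  obtain ⟨P, hP, hPc⟩ := h.exists_decomposition
  -- By `H`, supersets of `A` of dimension at most one are zero-dimensional, so adding pieces never
  -- leaves dimension zero.
  have key : ∀ k, HasSmallInductiveDimensionLT ↥(A ∪ ⋃ i ∈ Finset.range k, P i) 1 := by
    intro k
    induction k with
    | zero => exact hA.subset (by simp)
    | succ k ih =>
      have : (A ∪ ⋃ i ∈ Finset.range (k + 1), P i) = (A ∪ ⋃ i ∈ Finset.range k, P i) ∪ P k := by
        rw [Finset.range_add_one, Finset.set_biUnion_insert, union_comm (P k), union_assoc]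
      rw [this]
      exact H _ (subset_union_left.trans subset_union_left) (ih.union (hP k))
  have hm : ∀ x, x ∈ A ∪ ⋃ i ∈ Finset.range n, P i := by
    intro x
    obtain ⟨i, hi, hx⟩ := hPc x
    exact .inr (mem_biUnion (x := i) (by simpa using hi) hx)
  exact h1 (IsInducing.hasSmallInductiveDimensionLT (IsInducing.id.codRestrict hm) (key n))

end GeneralPosition

theorem mainTheorem11 {X : Type*} [TopologicalSpace X] [CompactSpace X]
    [TopologicalSpace.MetrizableSpace X] (n : ℕ) (hn : smallInductiveDimension X = n)
    (m : ℕ) (hm : n / 2 < m) :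
    ∃ A : Fin m → Set X, IsKCover A (n / 2 + 1) ∧
      (∀ i, smallInductiveDimension (A i) ≤ 1) ∧
      (1 ≤ n → ∀ i, smallInductiveDimension (A i) = 1) := by
  have hsc : SecondCountableTopology X := by
    let _ := metrizableSpaceMetric X
    infer_instance
  have hX : HasSmallInductiveDimensionLT X (n + 1) := smallInductiveDimension_le_iff.1 hn.le
  obtain ⟨B, hB, hBc⟩ := hX.exists_zero_dimensional_cover
  have hA : ∀ i, ∃ A, B (2 * i) ∪ B (2 * i + 1) ⊆ A ∧ HasSmallInductiveDimensionLT A 2 ∧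
      (1 ≤ n → ¬ HasSmallInductiveDimensionLT A 1) := by
    intro i
    have hu := (hB (2 * i)).union (hB (2 * i + 1))
    by_cases h : 1 ≤ n ∧ HasSmallInductiveDimensionLT ↥(B (2 * i) ∪ B (2 * i + 1)) 1
    · have hX1 : ¬ HasSmallInductiveDimensionLT X 1 := by
        rw [← smallInductiveDimension_lt_iff, hn]
        exact_mod_cast not_lt.2 h.1
      obtain ⟨A, h1, h2, h3⟩ := hX.exists_superset_one_dimensional hX1 h.2
      exact ⟨A, h1, h2, fun _ ↦ h3⟩
    · exact ⟨_, Subset.rfl, hu, fun h1 h2 ↦ h ⟨h1, h2⟩⟩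
  choose A hBA hA2 hA1 using hA
  refine ⟨fun i ↦ A i, fun s hs ↦ eq_univ_of_forall fun x ↦ ?_, fun i ↦ ?_, fun h1 i ↦ ?_⟩
  · by_contra hx
    simp only [mem_iUnion, not_exists] at hx
    -- An uncovered `x` misses `B` at both indices `2 * i` and `2 * i + 1` for each `i ∈ s`, which
    -- is too many.
    have hlt := hBc x (((s.map Fin.valEmbedding).image (2 * ·)) ∪
      ((s.map Fin.valEmbedding).image (2 * · + 1))) (by
        intro j hj
        simp only [Finset.mem_union, Finset.mem_image, Finset.mem_map] at hj
        rcases hj with ⟨_, ⟨i, hi, rfl⟩, rfl⟩ | ⟨_, ⟨i, hi, rfl⟩, rfl⟩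
        · exact fun hxB ↦ hx i hi (hBA _ (.inl hxB))
        · exact fun hxB ↦ hx i hi (hBA _ (.inr hxB)))
    rw [Finset.card_union_of_disjoint, Finset.card_image_of_injective _ fun a b h ↦ by
      simpa using h, Finset.card_image_of_injective _ fun a b h ↦ by simpa using h,
      Finset.card_map, hs] at hlt
    · omega
    · rw [Finset.disjoint_left]
      intro j hj hj'
      simp only [Finset.mem_image] at hj hj'
      obtain ⟨a, -, rfl⟩ := hj
      obtain ⟨b, -, hb⟩ := hj'
      omega
  · exact_mod_cast smallInductiveDimension_le_iff.2 (hA2 i)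
  · exact_mod_cast smallInductiveDimension_eq 1 (hA2 i) (hA1 i h1)
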